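/- Let $n\ge 0$ be an integer, let $\mathrm{Sym}(2^n)$ be the symmetric group on the letters $\{1,\dots,2^n\}$, and write $x^g=g^{-1}xg$. For $m<n$ regard $\mathrm{Sym}(2^m)$ as the subgroup of $\mathrm{Sym}(2^n)$ that fixes every letter greater than $2^m$. For $1\le m\le n$ let $\mathcal B^n_m$ be the partition of $\{1,\dots,2^n\}$ into the $2^m$ blocks $\{k2^{n-m}+1,\dots,(k+1)2^{n-m}\}$, $0\le k\le 2^m-1$, and let $\Sigma_n=\bigcap_{m=1}^n \mathrm{Stab}_{\mathrm{Sym}(2^n)}(\mathcal B^n_m)$, a Sylow $2$-subgroup of $\mathrm{Sym}(2^n)$. For $i\ge 1$ put $s_i=\prod_{j=1}^{2^{i-1}}(j,\,j+2^{i-1})$, and define $t^n_n=s_n$ and $t^n_i=t^{n-1}_i\cdot(t^{n-1}_i)^{s_n}$ for $1\le i<n$. Let $T_{n,i}=\langle t^n_1,\dots,t^n_i\rangle$ for $0\le i\le n$ (so $T_{n,0}=\{1\}$), and let $T_n=T_{n,n}$, which is an elementary abelian regular subgroup of $\mathrm{Sym}(2^n)$; the chain $\{1\}=T_{n,0}<T_{n,1}<\dots<T_{n,n}=T_n$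 is a maximal flag of $T_n$. Let $U_n=N_{\Sigma_n}(T_n)=\Sigma_n\cap N_{\mathrm{Sym}(2^n)}(T_n)$ and $N^1_n=N_{\mathrm{Sym}(2^n)}(U_n)$. Proposition. The group $N^1_n$ normalizes each of the terms $T_{n,0},\dots,T_{n,n-2}$ of this flag; that is, $(T_{n,i})^g=T_{n,i}$ for every $g\in N^1_n$ and every integer $i$ with $0\le i\le n-2$. -/

import Mathlib

namespace SylowChain

/-- The set `X_n = {1, …, 2^n}`. -/
abbrev X (n : ℕ) : Type := {x : ℕ // 1 ≤ x ∧ x ≤ 2 ^ n}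

/-- The symmetric group `Sym(2^n)` on the letters `1, …, 2^n`. -/
abbrev Sym (n : ℕ) : Type := Equiv.Perm (X n)

/-- The block `B^n_{m,k} = {k 2^{n-m} + 1, …, (k+1) 2^{n-m}}` (for `m ≤ n`, `k < 2^m`). -/
def block (n m k : ℕ) : Set (X n) :=
  {x | k * 2 ^ (n - m) + 1 ≤ x.1 ∧ x.1 ≤ (k + 1) * 2 ^ (n - m)}

/-- The partition `𝓑^n_m = {B^n_{m,0}, …, B^n_{m,2^m-1}}` of `X_n` (for `m ≤ n`). -/
def blocks (n m : ℕ) : Set (Set (X n)) :=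
  {B | ∃ k : ℕ, k < 2 ^ m ∧ B = block n m k}

open scoped Pointwise in
/-- `Σ_n`, the intersection for `m = 1, …, n` of the stabilizers in `Sym(2^n)` of the
partitions `𝓑^n_m`. -/
def SigmaGroup (n : ℕ) : Subgroup (Sym n) :=
  ⨅ m ∈ Finset.Icc 1 n, MulAction.stabilizer (Sym n) (blocks n m)

/-- The inclusion `X_n ⊆ X_{n+1}`. -/
def incl (n : ℕ) (x : X n) : X (n + 1) :=
  ⟨x.1, x.2.1, x.2.2.trans (Nat.pow_le_pow_right (by norm_num) (Nat.le_succ n))⟩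

/-- The map `j ↦ j + 2^n` from `X_n` to `X_{n+1}`. -/
def shift (n : ℕ) (x : X n) : X (n + 1) :=
  ⟨x.1 + 2 ^ n, by have := x.2.1; omega, by have := x.2.2; rw [pow_succ]; omega⟩

theorem incl_injective (n : ℕ) : Function.Injective (incl n) := fun _ _ h =>
  Subtype.ext (congrArg (fun z : X (n + 1) => z.1) h)

/-- The inclusion `Sym(2^n) ≤ Sym(2^{n+1})`: a permutation of `{1, …, 2^n}` is extended so as
to fix every letter greater than `2^n`. -/
noncomputable def extendSym (n : ℕ) : Sym n →* Sym (n + 1) :=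
  Equiv.Perm.viaEmbeddingHom ⟨incl n, incl_injective n⟩

/-- The `j`-th letter of `X_n`, counting from `0`; it is the number `j + 1`. -/
def letter (n : ℕ) (j : Fin (2 ^ n)) : X n := ⟨j.1 + 1, Nat.le_add_left 1 j.1, j.2⟩

/-- The element `s_{n+1} = (1, 1+2^n) (2, 2+2^n) ⋯ (2^n, 2^n+2^n)` of `Sym(2^{n+1})`. -/
def s (n : ℕ) : Sym (n + 1) :=
  (List.ofFn fun j : Fin (2 ^ n) =>
    Equiv.swap (incl n (letter n j)) (shift n (letter n j))).prod

/-- The elements `t^n_i` of `Sym(2^n)`, meaningful for `1 ≤ i ≤ n`: `t^n_n = s_n`, and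
`t^n_i = t^{n-1}_i · (t^{n-1}_i)^{s_n}` for `1 ≤ i < n`. -/
noncomputable def t : (n i : ℕ) → Sym n
  | 0, _ => 1
  | n + 1, i =>
      if i = n + 1 then s n
      else extendSym n (t n i) * ((s n)⁻¹ * extendSym n (t n i) * s n)

/-- The term `T_{n,i} = ⟨t^n_1, …, t^n_i⟩` of the maximal flag of `T_n` (for `i ≤ n`); in
particular `T_{n,0} = {1}`. -/
def Tflag (n i : ℕ) : Subgroup (Sym n) :=
  Subgroup.closure {g | ∃ j : ℕ, 1 ≤ j ∧ j ≤ i ∧ g = t n j}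

/-- The elementary abelian regular group `T_n = T_{n,n}`. -/
def T (n : ℕ) : Subgroup (Sym n) := Tflag n n

/-- The affine group `AGL(T_n)`, that is, the normalizer of `T_n` in `Sym(2^n)`. -/
def AGL (n : ℕ) : Subgroup (Sym n) := Subgroup.normalizer (T n)

/-- `U_n = AGL(T_n) ∩ Σ_n = N_{Σ_n}(T_n)`. -/
def U (n : ℕ) : Subgroup (Sym n) := AGL n ⊓ SigmaGroup n

/-- The normalizer chain of `T_n`: `N^0_n = U_n` and `N^k_n = N_{Sym(2^n)}(N^{k-1}_n)` for
`k ≥ 1`. -/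
def N (n : ℕ) : ℕ → Subgroup (Sym n)
  | 0 => U n
  | k + 1 => Subgroup.normalizer (N n k)

end SylowChain

namespace SylowChain

open Equiv

/-! Identify the letter `x` with the binary digits of `x - 1`. Then `T_n` becomes the translation
group of 𝔽₂ⁿ, the flag becomes the translations by the first `i` coordinates, and `U_n` becomes a
group of affine maps preserving the flag and containing all translations and upper transvections.

Let `g` normalize `U_n`. The conjugate of `T_n` by `g` is regular, so it defines a second addition
`circ g` on 𝔽₂ⁿ with neutral element 0. It lies in `U_n`, hence consists of affine maps, so the
difference `dev g` of the two additions is biadditive and alternating. As `U_n` also normalizes this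
conjugate, `dev g` is equivariant under transvections and its values lie in its own radical. This
forces the first `n - 2` basis vectors into the radical (`dev_eq_zero_of_mem_flag`).

So for `i ≤ n - 2` the two additions agree on `T_{n,i}`, and conjugating it back by `g` gives a
translation group again, still normalized by `U_n`. Transvection-invariant subspaces are comparable
with each flag term (`le_flag_or_flag_le`), and equal orders finish the proof. -/

/-- The space `𝔽₂ⁿ`. -/
abbrev Vec (n : ℕ) : Type := Fin n → ZMod 2

/-! ### The standard flag and upper transvections -/

/-- The vectors of `𝔽₂ⁿ` supported on the first `i` coordinates. -/
def flag (n i : ℕ) : AddSubgroup (Vec n) where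
  carrier := {x | ∀ j : Fin n, i ≤ j.1 → x j = 0}
  zero_mem' := fun _ _ => rfl
  add_mem' := fun {x y} hx hy j hj => by simp [hx j hj, hy j hj]
  neg_mem' := fun {x} hx j hj => by simp [hx j hj]

theorem mem_flag {n i : ℕ} {x : Vec n} : x ∈ flag n i ↔ ∀ j : Fin n, i ≤ j.1 → x j = 0 := Iff.rfl

theorem mem_flag_self {n : ℕ} (x : Vec n) : x ∈ flag n n := fun j hj => absurd j.2 (by omega)

theorem zmod_two_eq_one {a : ZMod 2} (h : a ≠ 0) : a = 1 := by
  revert a; decide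

theorem mem_of_single_mem {n : ℕ} (W : AddSubgroup (Vec n)) (x : Vec n)
    (h : ∀ j, x j ≠ 0 → Pi.single j 1 ∈ W) : x ∈ W := by
  rw [← Finset.univ_sum_single x]
  refine sum_mem fun j _ => ?_
  by_cases hj : x j = 0
  · rw [hj, Pi.single_zero]; exact zero_mem W
  · rw [zmod_two_eq_one hj]; exact h j hj

/-- The transvection `x ↦ x + x_j e_i`. -/
def shear {n : ℕ} {i j : Fin n} (h : i < j) : Vec n ≃+ Vec n where
  toFun x := x + Pi.single i (x j)
  invFun x := x + Pi.single i (x j)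
  left_inv x := by
    simp [Pi.single_eq_of_ne h.ne', add_assoc, ZModModule.add_self]
  right_inv x := by
    simp [Pi.single_eq_of_ne h.ne', add_assoc, ZModModule.add_self]
  map_add' x y := by
    simp only [Pi.add_apply, Pi.single_add]; abel

theorem shear_apply {n : ℕ} {i j : Fin n} (h : i < j) (x : Vec n) :
    shear h x = x + Pi.single i (x j) := rfl

/-- The difference `shear h x - x` is `x_j e_i`, and a nonzero scalar of 𝔽₂ is 1. -/
theorem single_mem_of_shear_mem {n : ℕ} {W : AddSubgroup (Vec n)}
    (hW : ∀ (i j : Fin n) (h : i < j), ∀ x ∈ W, shear h x ∈ W)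
    {x : Vec n} (hx : x ∈ W) {i j : Fin n} (hj : x j ≠ 0) (hij : i < j) :
    Pi.single i 1 ∈ W := by
  have h1 := W.sub_mem (hW i j hij x hx) hx
  rwa [shear_apply, add_sub_cancel_left, zmod_two_eq_one hj] at h1

/-- A subgroup of `𝔽₂ⁿ` that is invariant under upper transvections is comparable with each
term of the standard flag. -/
theorem le_flag_or_flag_le {n : ℕ} {W : AddSubgroup (Vec n)}
    (hW : ∀ (i j : Fin n) (h : i < j), ∀ x ∈ W, shear h x ∈ W) (i : ℕ) :
    W ≤ flag n i ∨ flag n i ≤ W := by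
  by_contra! hcon
  obtain ⟨h1, h2⟩ := hcon
  obtain ⟨x, hx, hxi⟩ := SetLike.not_le_iff_exists.1 h1
  rw [mem_flag] at hxi
  push Not at hxi
  obtain ⟨j, hij, hj⟩ := hxi
  -- The nonzero coordinate `j ≥ i` of `x` puts every `e_k` with `k < i` into `W`.
  refine h2 fun y hy => mem_of_single_mem W y fun k hk => ?_
  refine single_mem_of_shear_mem hW hx hj (Fin.lt_def.2 (lt_of_lt_of_le ?_ hij))
  by_contra hki
  exact hk (hy k (not_lt.1 hki))

/-! ### The conjugated addition and its deviation -/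

/-- The value at `v`, `w` of the operation obtained by transporting the addition of `𝔽₂ⁿ`
along `g` so that `0` stays the neutral element. -/
def circ {n : ℕ} (g : Perm (Vec n)) (v w : Vec n) : Vec n := g (g⁻¹ w + g⁻¹ v + g⁻¹ 0)

/-- The deviation of `circ g` from the addition. -/
def dev {n : ℕ} (g : Perm (Vec n)) (v w : Vec n) : Vec n := circ g v w + v + w

section dev

variable {n : ℕ} (g : Perm (Vec n))

theorem circ_comm (v w : Vec n) : circ g v w = circ g w v := by
  simp only [circ, add_comm (g⁻¹ w)]

theorem circ_self (v : Vec n) : circ g v v = 0 := by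
  simp [circ, ZModModule.add_self]

theorem circ_zero (v : Vec n) : circ g v 0 = v := by
  rw [circ, add_right_comm, ZModModule.add_self, zero_add]
  exact g.apply_symm_apply v

theorem dev_comm (v w : Vec n) : dev g v w = dev g w v := by
  simp only [dev, circ_comm g v w]; abel

theorem dev_self (v : Vec n) : dev g v v = 0 := by
  simp [dev, circ_self, ZModModule.add_self]

theorem circ_eq (v w : Vec n) : circ g v w = w + v + dev g v w := by
  have : w + v + dev g v w = circ g v w + (v + v) + (w + w) := by simp only [dev]; abel
  simp [this, ZModModule.add_self]

/-- The permutation `circ g v ·`, a conjugate under `g` of a translation. -/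
theorem conj_addRight_apply (v w : Vec n) :
    (g * Equiv.addRight (g⁻¹ v + g⁻¹ 0) * g⁻¹) w = circ g v w := by
  simp [circ, add_assoc]

variable {g} {U : Subgroup (Perm (Vec n))} (hg : g ∈ Subgroup.normalizer (U : Set (Perm (Vec n))))
  (hT : ∀ v, Equiv.addRight v ∈ U)
  (hU : ∀ u ∈ U, ∀ i, ∀ v ∈ flag n i, ∃ w ∈ flag n i, ∀ x, u (x + v) = u x + w)
include hg hT hU

/-- The map `circ g v` lies in `U` because `g` normalizes `U`; being affine, it differs from its
linear part by its value `v` at 0. -/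
theorem dev_add_right (v x w : Vec n) : dev g v (x + w) = dev g v x + dev g v w := by
  have hmem := (Subgroup.mem_normalizer_iff.1 hg _).1 (hT (g⁻¹ v + g⁻¹ 0))
  obtain ⟨w', -, h⟩ := hU _ hmem n w (mem_flag_self w)
  simp only [conj_addRight_apply] at h
  have h0 := h 0
  have hx := h x
  rw [zero_add, circ_zero] at h0
  have : w' = circ g v w + v := by
    rw [h0, add_right_comm, ZModModule.add_self, zero_add]
  simp only [dev, hx, this]
  abel

theorem dev_add_left (v x w : Vec n) : dev g (x + w) v = dev g x v + dev g w v := by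
  simp only [dev_comm g _ v]
  exact dev_add_right hg hT hU v x w

omit hT in
-- Conjugating `u` by `g` stays in `U`, which normalizes the translations; so `u` itself normalizes
-- their conjugates under `g`.
theorem exists_circ_conj {u : Perm (Vec n)} (hu : u ∈ U) (v : Vec n) :
    ∃ b, ∀ x, u (circ g v x) = circ g b (u x) := by
  have hmem := (Subgroup.mem_normalizer_iff''.1 hg u).1 hu
  obtain ⟨c, -, h⟩ := hU _ hmem n (g⁻¹ v + g⁻¹ 0) (mem_flag_self _)
  refine ⟨g (c + g⁻¹ 0), fun x => ?_⟩
  have hx := congrArg g (h (g⁻¹ x))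
  simp only [Perm.mul_apply, Perm.inv_def, Equiv.apply_symm_apply] at hx
  rw [circ, circ, add_assoc]
  simp [hx, add_assoc, ZModModule.add_self]

omit hT in
theorem map_dev (u : Vec n ≃+ Vec n) (hu : u.toEquiv ∈ U) (v w : Vec n) :
    u (dev g v w) = dev g (u v) (u w) := by
  obtain ⟨b, hb⟩ := exists_circ_conj hg hU hu v
  simp only [AddEquiv.toEquiv_eq_coe, AddEquiv.coe_toEquiv] at hb
  have h0 := hb 0
  rw [map_zero, circ_zero, circ_zero] at h0
  simp only [dev, map_add, hb, h0]

/-- Conjugating `circ g v` by translation by `w` gives some `circ g b`; evaluation at 0 yields `b =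
v + dev g v w`, and comparison at `y` leaves only the claimed term. -/
theorem dev_dev (v w y : Vec n) : dev g (dev g v w) y = 0 := by
  obtain ⟨b, hb⟩ := exists_circ_conj hg hU (hT w) v
  simp only [Equiv.coe_addRight] at hb
  have key : ∀ y, circ g b y = circ g v y + dev g v w := fun y => by
    have h1 := hb (y + w)
    rw [add_assoc, ZModModule.add_self, add_zero] at h1
    rw [← h1, circ_eq, circ_eq, dev_add_right hg hT hU]
    have : y + w + v + (dev g v y + dev g v w) + w
      = y + v + dev g v y + dev g v w + (w + w) := by abel
    rw [this, ZModModule.add_self, add_zero]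
  have h0 := key 0
  rw [circ_zero, circ_zero] at h0
  have h2 := key y
  rw [h0, circ_eq, circ_eq, dev_add_left hg hT hU] at h2
  have h3 : y + (v + dev g v w) + (dev g v y + dev g (dev g v w) y)
    = y + v + dev g v y + dev g v w + dev g (dev g v w) y := by abel
  rw [h3] at h2
  exact left_eq_add.1 h2.symm

variable (hE : ∀ (i j : Fin n) (h : i < j), (shear h).toEquiv ∈ U)
include hE

/-- The radical `W` is transvection-invariant. Were `e_a` the first missing basis vector with `a + 2
< n`, elements of `W` would vanish beyond `a`; since values of `dev g` lie in `W`, transvections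
would then kill every `dev g e_c e_a`. -/
theorem dev_eq_zero_of_mem_flag {i : ℕ} (hi : i + 2 ≤ n) {v : Vec n} (hv : v ∈ flag n i)
    (w : Vec n) : dev g v w = 0 := by
  let W : AddSubgroup (Vec n) :=
    { carrier := {v | ∀ w, dev g v w = 0}
      zero_mem' := fun w => by simpa using dev_add_left hg hT hU w 0 0
      add_mem' := fun {x y} hx hy w => by rw [dev_add_left hg hT hU, hx, hy, add_zero]
      neg_mem' := fun {x} hx w => by rw [ZModModule.neg_eq_self]; exact hx w }
  have hWE : ∀ (i j : Fin n) (h : i < j), ∀ x ∈ W, shear h x ∈ W := fun i j h x hx w => by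
    obtain ⟨w, rfl⟩ := (shear h).surjective w
    rw [← map_dev hg hU _ (hE i j h), hx, map_zero]
  have hsingle : ∀ k : ℕ, ∀ hk : k + 2 < n,
      (Pi.single (⟨k, by omega⟩ : Fin n) 1 : Vec n) ∈ W := by
    intro k
    induction k using Nat.strong_induction_on with
    | _ k ih =>
    intro hk
    by_contra hkW
    set a : Fin n := ⟨k, by omega⟩ with ha
    have hW0 : ∀ x ∈ W, ∀ j, a < j → x j = 0 := fun x hx j hj => by
      by_contra hxj
      exact hkW (single_mem_of_shear_mem hWE hx hxj hj)
    refine hkW fun w => ?_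
    rw [dev_comm]
    let K : AddSubgroup (Vec n) :=
      { carrier := {v | dev g v (Pi.single a 1) = 0}
        zero_mem' := by simpa using dev_add_left hg hT hU (Pi.single a 1) 0 0
        add_mem' := fun {x y} hx hy => by
          rw [Set.mem_ofPred_eq] at *
          rw [dev_add_left hg hT hU, hx, hy, add_zero]
        neg_mem' := fun {x} hx => by rw [ZModModule.neg_eq_self]; exact hx }
    refine mem_of_single_mem K w fun c _ => ?_
    show dev g (Pi.single c 1) (Pi.single a 1) = 0
    rcases lt_trichotomy c a with hc | rfl | hc
    · exact ih c.1 hc (by have := Fin.lt_def.1 hc; simp only [ha] at this; omega) _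
    · exact dev_self g _
    -- At least two indices exceed `a`, so one of them differs from `c`; this is where codimension 2
    -- is needed.
    · obtain ⟨j, haj, hjc⟩ : ∃ j : Fin n, a < j ∧ j ≠ c := by
        by_cases h : c.1 = k + 1
        · exact ⟨⟨k + 2, by omega⟩, Fin.lt_def.2 (by simp [ha]), fun h' => by
            have := congrArg Fin.val h'; simp only at this; omega⟩
        · exact ⟨⟨k + 1, by omega⟩, Fin.lt_def.2 (by simp [ha]), fun h' => by
            have := congrArg Fin.val h'; simp only at this; omega⟩
      -- This transvection sends `e_j` to `e_j + e_a`, fixes `e_c`, and fixes the value `dev g e_c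
      -- e_j`, whose `j`-th coordinate is 0.
      have h1 := map_dev hg hU _ (hE a j haj) (Pi.single c 1) (Pi.single j 1)
      have hD : dev g (Pi.single c 1) (Pi.single j 1) ∈ W := dev_dev hg hT hU _ _
      rw [shear_apply, shear_apply, shear_apply, hW0 _ hD j haj, Pi.single_zero, add_zero,
        Pi.single_eq_of_ne hjc, Pi.single_zero, add_zero, Pi.single_eq_same,
        dev_add_right hg hT hU] at h1
      exact left_eq_add.1 h1
  refine mem_of_single_mem W v (fun j hj => ?_) w
  refine hsingle j.1 ?_
  by_contra h
  exact hj (hv j (by omega))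

end dev

/-! ### Translation groups and the theorem over 𝔽₂ⁿ -/

/-- The group of translations of `𝔽₂ⁿ` by the elements of a subgroup. -/
def translations {n : ℕ} (W : AddSubgroup (Vec n)) : Subgroup (Perm (Vec n)) where
  carrier := {f | ∃ v ∈ W, f = Equiv.addRight v}
  one_mem' := ⟨0, zero_mem W, by ext; simp⟩
  mul_mem' := by
    rintro _ _ ⟨v, hv, rfl⟩ ⟨w, hw, rfl⟩
    exact ⟨w + v, add_mem hw hv, by ext; simp [add_assoc]⟩
  inv_mem' := by
    rintro _ ⟨v, hv, rfl⟩
    exact ⟨-v, neg_mem hv, by ext; simp⟩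

/-- The vectors of the translations contained in a group of permutations of `𝔽₂ⁿ`. -/
def translationVectors {n : ℕ} (P : Subgroup (Perm (Vec n))) : AddSubgroup (Vec n) where
  carrier := {v | Equiv.addRight v ∈ P}
  zero_mem' := by
    have : Equiv.addRight (0 : Vec n) = 1 := by ext; simp
    rw [Set.mem_ofPred_eq, this]; exact one_mem P
  add_mem' := fun {x y} hx hy => by
    have : Equiv.addRight (x + y) = Equiv.addRight y * Equiv.addRight x := by
      ext; simp [add_assoc]
    rw [Set.mem_ofPred_eq, this]; exact mul_mem hy hx
  neg_mem' := fun {x} hx => by rw [ZModModule.neg_eq_self]; exact hx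

theorem conj_addRight {n : ℕ} {u : Perm (Vec n)} {v w : Vec n}
    (h : ∀ x, u (x + v) = u x + w) : u * Equiv.addRight v * u⁻¹ = Equiv.addRight w := by
  ext1 x
  simp [h]

/-- Let `U` be a group of affine permutations of `𝔽₂ⁿ` that preserves the standard flag and
contains all translations and all upper transvections. Then the normalizer of `U` normalizes the
translations by the terms of codimension at least `2` of the flag. -/
theorem mem_normalizer_translations_flag {n : ℕ} {U : Subgroup (Perm (Vec n))}
    (hT : ∀ v, Equiv.addRight v ∈ U)
    (hU : ∀ u ∈ U, ∀ i, ∀ v ∈ flag n i, ∃ w ∈ flag n i, ∀ x, u (x + v) = u x + w)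
    (hE : ∀ (i j : Fin n) (h : i < j), (shear h).toEquiv ∈ U)
    {g : Perm (Vec n)} (hg : g ∈ Subgroup.normalizer (U : Set (Perm (Vec n)))) {i : ℕ}
    (hi : i + 2 ≤ n) :
    g ∈ Subgroup.normalizer (translations (flag n i) : Set (Perm (Vec n))) := by
  have hnorm : ∀ u ∈ U, ∀ f ∈ translations (flag n i), u * f * u⁻¹ ∈ translations (flag n i) := by
    rintro u hu _ ⟨v, hv, rfl⟩
    obtain ⟨w, hw, h⟩ := hU u hu i v hv
    exact ⟨w, hw, conj_addRight h⟩
  set P := (translations (flag n i)).comap (MulAut.conj g).toMonoidHom with hP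
  have hPmem : ∀ f, f ∈ P ↔ g * f * g⁻¹ ∈ translations (flag n i) := fun f => by
    simp [hP, Subgroup.mem_comap]
  -- For `v` in the flag term, `circ g v` is translation by `v`, so its conjugate back is a
  -- translation.
  have hPT : ∀ f ∈ P, ∃ w, f = Equiv.addRight w := fun f hf => by
    obtain ⟨v, hv, h⟩ := (hPmem f).1 hf
    refine ⟨g⁻¹ v + g⁻¹ 0, ?_⟩
    have h2 : g * Equiv.addRight (g⁻¹ v + g⁻¹ 0) * g⁻¹ = Equiv.addRight v := by
      ext1 x
      rw [conj_addRight_apply, circ_eq, dev_eq_zero_of_mem_flag hg hT hU hE hi hv, add_zero,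
        Equiv.coe_addRight]
    rw [← h] at h2
    exact (mul_left_cancel (mul_right_cancel h2)).symm
  have hPU : ∀ u ∈ U, ∀ f ∈ P, u * f * u⁻¹ ∈ P := fun u hu f hf => by
    rw [hPmem] at hf ⊢
    have := hnorm _ ((Subgroup.mem_normalizer_iff.1 hg u).1 hu) _ hf
    convert this using 1
    group
  set W := translationVectors P
  have hWP : translations W = P := by
    ext f
    constructor
    · rintro ⟨v, hv, rfl⟩; exact hv
    · intro hf
      obtain ⟨w, rfl⟩ := hPT f hf
      exact ⟨w, hf, rfl⟩
  have hWE : ∀ (i j : Fin n) (h : i < j), ∀ x ∈ W, shear h x ∈ W := fun a b h x hx => by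
    have h1 := hPU _ (hE a b h) _ hx
    rwa [conj_addRight (w := shear h x) (fun y => by simp)] at h1
  have hcard : Nat.card P = Nat.card (translations (flag n i)) := by
    refine Nat.card_congr (((MulAut.conj g).toEquiv).subtypeEquiv fun f => ?_)
    rw [hPmem]; rfl
  have hmono : ∀ {A B : AddSubgroup (Vec n)}, A ≤ B → translations A ≤ translations B := by
    rintro A B hAB _ ⟨v, hv, rfl⟩
    exact ⟨v, hAB hv, rfl⟩
  have heq : P = translations (flag n i) := by
    rcases le_flag_or_flag_le hWE i with h | h
    · exact Subgroup.eq_of_le_of_card_ge (hWP ▸ hmono h) hcard.ge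
    · exact (Subgroup.eq_of_le_of_card_ge (hWP ▸ hmono h) hcard.le).symm
  rw [Subgroup.mem_normalizer_iff]
  intro f
  rw [← hPmem, heq]

/-! ### Binary coordinates on the letters -/

/-- The binary digits of `x - 1`, for `x ∈ X_n`. -/
def bits (n : ℕ) (x : X n) : Vec n := fun j => if (x.1 - 1).testBit j then 1 else 0

theorem bits_eq_iff {n : ℕ} {x y : X n} {j : Fin n} :
    bits n x j = bits n y j ↔ (x.1 - 1).testBit j = (y.1 - 1).testBit j := by
  unfold bits
  rcases (x.1 - 1).testBit j <;> rcases (y.1 - 1).testBit j <;> simp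

theorem sub_one_lt {n : ℕ} (x : X n) : x.1 - 1 < 2 ^ n := by
  have := x.2; omega

theorem div_eq_div_iff_bits {n a : ℕ} {x y : X n} :
    (x.1 - 1) / 2 ^ a = (y.1 - 1) / 2 ^ a ↔ ∀ j : Fin n, a ≤ j → bits n x j = bits n y j := by
  simp only [bits_eq_iff]
  constructor
  · intro h j hj
    have h1 := congrArg (fun m : ℕ => m.testBit (j.1 - a)) h
    simpa only [Nat.testBit_div_two_pow, Nat.sub_add_cancel hj] using h1
  · intro h
    refine Nat.eq_of_testBit_eq fun k => ?_
    rw [Nat.testBit_div_two_pow, Nat.testBit_div_two_pow]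
    by_cases hk : k + a < n
    · exact h ⟨k + a, hk⟩ (Nat.le_add_left _ _)
    · have hlt : 2 ^ n ≤ 2 ^ (k + a) := Nat.pow_le_pow_right (by norm_num) (not_lt.1 hk)
      rw [Nat.testBit_lt_two_pow ((sub_one_lt x).trans_le hlt),
        Nat.testBit_lt_two_pow ((sub_one_lt y).trans_le hlt)]

theorem letter_bijective (n : ℕ) : Function.Bijective (letter n) := by
  constructor
  · intro a b h
    have := congrArg Subtype.val h
    simp only [letter] at this
    exact Fin.ext (by omega)
  · intro x
    refine ⟨⟨x.1 - 1, sub_one_lt x⟩, Subtype.ext ?_⟩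
    have := x.2.1
    simp only [letter]
    omega

instance (n : ℕ) : Fintype (X n) := Fintype.ofBijective _ (letter_bijective n)

theorem bits_bijective (n : ℕ) : Function.Bijective (bits n) := by
  refine (Fintype.bijective_iff_injective_and_card _).2 ⟨fun x y h => ?_, ?_⟩
  · have h1 := (div_eq_div_iff_bits (a := 0) (x := x) (y := y)).2 fun j _ => congrFun h j
    rw [pow_zero, Nat.div_one, Nat.div_one] at h1
    have := x.2.1
    have := y.2.1
    exact Subtype.ext (by omega)
  · rw [← Fintype.card_of_bijective (letter_bijective n)]
    simp [Fintype.card_pi]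

/-- The bijection of `X_n` with `𝔽₂ⁿ` given by binary digits. -/
noncomputable def bitsEquiv (n : ℕ) : X n ≃ Vec n := Equiv.ofBijective _ (bits_bijective n)

/-! ### The generators `t` as translations by basis vectors -/

theorem shift_injective (n : ℕ) : Function.Injective (shift n) := fun x y h => by
  have := congrArg Subtype.val h
  simp only [shift] at this
  exact Subtype.ext (by omega)

theorem incl_ne_shift {n : ℕ} (x y : X n) : incl n x ≠ shift n y := fun h => by
  have h1 := congrArg Subtype.val h
  have := x.2
  have := y.2
  simp only [shift, incl] at h1
  omega

theorem exists_incl_or_shift {n : ℕ} (x : X (n + 1)) :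
    (∃ y, x = incl n y) ∨ ∃ y, x = shift n y := by
  have h := x.2
  have hp := pow_succ 2 n
  by_cases hx : x.1 ≤ 2 ^ n
  · exact Or.inl ⟨⟨x.1, h.1, hx⟩, rfl⟩
  · refine Or.inr ⟨⟨x.1 - 2 ^ n, by omega, by omega⟩, Subtype.ext ?_⟩
    simp only [shift]
    omega

/-- Both halves are tracked together over an arbitrary duplicate-free list so that the induction
closes. -/
theorem prod_swap_apply {n : ℕ} (l : List (X n)) (hl : l.Nodup) (y : X n) :
    ((l.map fun z => swap (incl n z) (shift n z)).prod (incl n y)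
        = if y ∈ l then shift n y else incl n y) ∧
      ((l.map fun z => swap (incl n z) (shift n z)).prod (shift n y)
        = if y ∈ l then incl n y else shift n y) := by
  induction l with
  | nil => simp
  | cons a l ih =>
    obtain ⟨ha, hl⟩ := List.nodup_cons.1 hl
    obtain ⟨h1, h2⟩ := ih hl
    simp only [List.map_cons, List.prod_cons, Perm.mul_apply, h1, h2, List.mem_cons]
    by_cases hya : y = a
    · subst hya
      simp [ha]
    · have e1 : swap (incl n a) (shift n a) (incl n y) = incl n y :=
        swap_apply_of_ne_of_ne (fun h => hya (incl_injective n h)) (incl_ne_shift _ _)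
      have e2 : swap (incl n a) (shift n a) (shift n y) = shift n y :=
        swap_apply_of_ne_of_ne (incl_ne_shift _ _).symm (fun h => hya (shift_injective n h))
      by_cases hyl : y ∈ l <;> simp [hya, hyl, e1, e2]

theorem s_apply (n : ℕ) (y : X n) :
    s n (incl n y) = shift n y ∧ s n (shift n y) = incl n y := by
  have h := prod_swap_apply (List.ofFn (letter n))
    (List.nodup_ofFn.2 (letter_bijective n).1) y
  have hy : y ∈ List.ofFn (letter n) := by
    rw [List.mem_ofFn]
    exact (letter_bijective n).2 y
  rw [List.map_ofFn] at h
  simp only [hy, if_true] at h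
  exact h

theorem extendSym_incl {n : ℕ} (f : Sym n) (y : X n) :
    extendSym n f (incl n y) = incl n (f y) :=
  Equiv.Perm.viaEmbedding_apply f ⟨incl n, incl_injective n⟩ y

theorem extendSym_shift {n : ℕ} (f : Sym n) (y : X n) :
    extendSym n f (shift n y) = shift n y :=
  Equiv.Perm.viaEmbedding_apply_of_notMem f ⟨incl n, incl_injective n⟩ _
    fun ⟨z, hz⟩ => incl_ne_shift z y hz

theorem t_succ_self (n : ℕ) : t (n + 1) (n + 1) = s n := by simp [t]

/-- Conjugation by `s n` moves the extended permutation to the upper half, so `t` acts as two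
parallel copies. -/
theorem t_succ_apply {n i : ℕ} (hi : i ≤ n) (y : X n) :
    t (n + 1) i (incl n y) = incl n (t n i y) ∧ t (n + 1) i (shift n y) = shift n (t n i y) := by
  have h3 : ∀ z, (s n)⁻¹ (shift n z) = incl n z := fun z =>
    Perm.inv_eq_iff_eq.2 (s_apply n z).1.symm
  have h4 : ∀ z, (s n)⁻¹ (incl n z) = shift n z := fun z =>
    Perm.inv_eq_iff_eq.2 (s_apply n z).2.symm
  rw [t, if_neg (by omega)]
  simp only [Perm.mul_apply, (s_apply n _).1, (s_apply n _).2, extendSym_incl, extendSym_shift,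
    h3, h4, and_self]

theorem testBit_incl {n : ℕ} (y : X n) (j : ℕ) :
    ((incl n y).1 - 1).testBit j = (y.1 - 1).testBit j := rfl

theorem testBit_shift {n : ℕ} (y : X n) (j : Fin (n + 1)) :
    ((shift n y).1 - 1).testBit j = if j.1 = n then true else (y.1 - 1).testBit j := by
  have h : (shift n y).1 - 1 = 2 ^ n + (y.1 - 1) := by
    have := y.2.1
    simp only [shift]
    omega
  rw [h]
  split_ifs with hj
  · rw [hj, Nat.testBit_two_pow_add_eq, Nat.testBit_lt_two_pow (sub_one_lt y)]
    rfl
  · exact Nat.testBit_two_pow_add_gt (by omega) _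

theorem testBit_self {n : ℕ} (y : X n) : (y.1 - 1).testBit n = false :=
  Nat.testBit_lt_two_pow (sub_one_lt y)

theorem testBit_t (n : ℕ) (a : Fin n) (x : X n) (j : Fin n) :
    ((t n (a + 1) x).1 - 1).testBit j = ((x.1 - 1).testBit j ^^ decide (j = a)) := by
  induction n with
  | zero => exact a.elim0
  | succ n ih =>
    by_cases ha : a.1 = n
    · rw [ha, t_succ_self]
      have hja : j = a ↔ j.1 = n := by rw [Fin.ext_iff, ha]
      rcases exists_incl_or_shift x with ⟨y, rfl⟩ | ⟨y, rfl⟩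
      · rw [(s_apply n y).1, testBit_shift, testBit_incl]
        by_cases hj : j.1 = n
        · simp [hja, hj, testBit_self]
        · simp [hja, hj]
      · rw [(s_apply n y).2, testBit_shift, testBit_incl]
        by_cases hj : j.1 = n
        · simp [hja, hj, testBit_self]
        · simp [hja, hj]
    · have han : a.1 < n := by omega
      have key : ∀ y : X n, j.1 < n → ((t n (a + 1) y).1 - 1).testBit j
          = ((y.1 - 1).testBit j ^^ decide (j = a)) := fun y hj => by
        have := ih ⟨a.1, han⟩ y ⟨j.1, hj⟩
        simpa only [Fin.ext_iff] using this
      rcases exists_incl_or_shift x with ⟨y, rfl⟩ | ⟨y, rfl⟩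
      · rw [(t_succ_apply (by omega) y).1, testBit_incl, testBit_incl]
        by_cases hj : j.1 = n
        · have : j ≠ a := fun h => ha (h ▸ hj)
          simp [this, hj, testBit_self]
        · exact key y (by omega)
      · rw [(t_succ_apply (by omega) y).2, testBit_shift, testBit_shift]
        by_cases hj : j.1 = n
        · have : j ≠ a := fun h => ha (h ▸ hj)
          simp [this, hj]
        · simp only [hj, if_false]
          exact key y (by omega)

theorem bits_t {n : ℕ} (a : Fin n) (x : X n) :
    bits n (t n (a + 1) x) = bits n x + Pi.single a 1 := by
  ext j
  rw [Pi.add_apply, Pi.single_apply, bits, bits, testBit_t]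
  by_cases hj : j = a <;> cases (x.1 - 1).testBit j <;> simp [hj]
  rfl

/-- The isomorphism of `Sym(2^n)` with the group of permutations of `𝔽₂ⁿ`. -/
noncomputable def symEquiv (n : ℕ) : Sym n ≃* Perm (Vec n) := (bitsEquiv n).permCongrHom

theorem symEquiv_apply_bits {n : ℕ} (f : Sym n) (x : X n) :
    symEquiv n f (bits n x) = bits n (f x) := by
  show bitsEquiv n (f ((bitsEquiv n).symm (bitsEquiv n x))) = _
  rw [Equiv.symm_apply_apply]
  rfl

theorem symEquiv_t {n : ℕ} (a : Fin n) :
    symEquiv n (t n (a + 1)) = Equiv.addRight (Pi.single a 1) := by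
  ext1 v
  obtain ⟨x, rfl⟩ := (bits_bijective n).2 v
  rw [symEquiv_apply_bits, bits_t, Equiv.coe_addRight]

theorem map_Tflag {n i : ℕ} (hi : i ≤ n) :
    (Tflag n i).map (symEquiv n).toMonoidHom = translations (flag n i) := by
  apply le_antisymm
  · rw [Subgroup.map_le_iff_le_comap, Tflag, Subgroup.closure_le]
    rintro _ ⟨j, hj1, hji, rfl⟩
    obtain ⟨a, rfl⟩ : ∃ a, j = a + 1 := ⟨j - 1, by omega⟩
    refine ⟨Pi.single ⟨a, by omega⟩ 1, fun k hk => Pi.single_eq_of_ne ?_ _,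
      symEquiv_t ⟨a, by omega⟩⟩
    rintro rfl
    simp only at hk
    omega
  · set P := (Tflag n i).map (symEquiv n).toMonoidHom
    rintro _ ⟨v, hv, rfl⟩
    refine mem_of_single_mem (translationVectors P) v fun a ha => ?_
    refine ⟨t n (a + 1), Subgroup.subset_closure ⟨a + 1, by omega, ?_, rfl⟩, symEquiv_t a⟩
    by_contra h
    exact ha (hv a (by omega))

/-! ### Blocks as cosets of the flag -/

theorem mem_block {n m k : ℕ} {x : X n} : x ∈ block n m k ↔ (x.1 - 1) / 2 ^ (n - m) = k := by
  have := x.2.1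
  rw [Nat.div_eq_iff (by positivity)]
  simp only [block, Set.mem_ofPred_eq]
  have h0 : 0 < 2 ^ (n - m) := by positivity
  rw [add_mul, one_mul]
  omega

/-- Blocks are nonempty. -/
theorem exists_mem_block {n m k : ℕ} (hm : m ≤ n) (hk : k < 2 ^ m) : ∃ x, x ∈ block n m k := by
  have h : (k + 1) * 2 ^ (n - m) ≤ 2 ^ m * 2 ^ (n - m) := Nat.mul_le_mul_right _ hk
  rw [← pow_add, Nat.add_sub_cancel' hm, add_mul, one_mul] at h
  have h0 : 0 < 2 ^ (n - m) := by positivity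
  refine ⟨⟨k * 2 ^ (n - m) + 1, by omega, by omega⟩, ?_⟩
  rw [mem_block, Nat.add_sub_cancel, Nat.mul_div_cancel _ h0]

theorem div_lt {n m : ℕ} (hm : m ≤ n) (x : X n) : (x.1 - 1) / 2 ^ (n - m) < 2 ^ m := by
  rw [Nat.div_lt_iff_lt_mul (by positivity), ← pow_add, Nat.add_sub_cancel' hm]
  exact sub_one_lt x

open scoped Pointwise in
theorem mem_stabilizer_blocks {n m : ℕ} (hm : m ≤ n) {u : Sym n} :
    u ∈ MulAction.stabilizer (Sym n) (blocks n m) ↔ ∀ x y : X n,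
      (x.1 - 1) / 2 ^ (n - m) = (y.1 - 1) / 2 ^ (n - m) ↔
        ((u x).1 - 1) / 2 ^ (n - m) = ((u y).1 - 1) / 2 ^ (n - m) := by
  have himp : ∀ u ∈ MulAction.stabilizer (Sym n) (blocks n m), ∀ x y : X n,
      (x.1 - 1) / 2 ^ (n - m) = (y.1 - 1) / 2 ^ (n - m) →
        ((u x).1 - 1) / 2 ^ (n - m) = ((u y).1 - 1) / 2 ^ (n - m) := by
    intro u hu x y hxy
    have hb : block n m ((y.1 - 1) / 2 ^ (n - m)) ∈ blocks n m := ⟨_, div_lt hm y, rfl⟩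
    have h1 : u • block n m ((y.1 - 1) / 2 ^ (n - m)) ∈ blocks n m := by
      rw [MulAction.mem_stabilizer_iff] at hu
      rw [← hu]
      exact Set.smul_mem_smul_set hb
    obtain ⟨k, -, hk⟩ := h1
    have hx : u x ∈ block n m k := hk ▸ Set.smul_mem_smul_set (mem_block.2 hxy)
    have hy : u y ∈ block n m k := hk ▸ Set.smul_mem_smul_set (mem_block.2 rfl)
    rw [mem_block.1 hx, mem_block.1 hy]
  have hsub : ∀ u : Sym n, (∀ x y : X n,
      (x.1 - 1) / 2 ^ (n - m) = (y.1 - 1) / 2 ^ (n - m) ↔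
        ((u x).1 - 1) / 2 ^ (n - m) = ((u y).1 - 1) / 2 ^ (n - m)) →
      u • blocks n m ⊆ blocks n m := by
    rintro u h _ ⟨_, ⟨k, hk, rfl⟩, rfl⟩
    obtain ⟨x, hx⟩ := exists_mem_block hm hk
    refine ⟨((u x).1 - 1) / 2 ^ (n - m), div_lt hm _, ?_⟩
    ext y
    obtain ⟨y, rfl⟩ := u.surjective y
    have hy : u y ∈ u • block n m k ↔ y ∈ block n m k :=
      Set.smul_mem_smul_set_iff (a := u) (x := y)
    refine hy.trans ?_
    rw [mem_block, mem_block, ← h, mem_block.1 hx]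
  constructor
  · intro hu x y
    refine ⟨himp u hu x y, fun h => ?_⟩
    simpa using himp u⁻¹ (inv_mem hu) _ _ h
  · intro h
    rw [MulAction.mem_stabilizer_iff]
    refine (hsub u h).antisymm ?_
    rw [Set.subset_smul_set_iff]
    refine hsub u⁻¹ fun x y => ?_
    simpa using (h (u⁻¹ x) (u⁻¹ y)).symm

/-- The blocks of level `m = n - i` have length `2 ^ i` and correspond to the cosets of `flag n i`.
-/
theorem mem_SigmaGroup {n : ℕ} {u : Sym n} :
    u ∈ SigmaGroup n ↔ ∀ i < n, ∀ v w : Vec n,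
      v + w ∈ flag n i ↔ symEquiv n u v + symEquiv n u w ∈ flag n i := by
  have hflag : ∀ (i : ℕ) (x y : X n), bits n x + bits n y ∈ flag n i ↔
      (x.1 - 1) / 2 ^ i = (y.1 - 1) / 2 ^ i := fun i x y => by
    rw [div_eq_div_iff_bits, mem_flag]
    refine forall₂_congr fun j _ => ?_
    rw [Pi.add_apply, ← ZModModule.sub_eq_add, sub_eq_zero]
  simp only [SigmaGroup, Subgroup.mem_iInf, Finset.mem_Icc]
  constructor
  · intro h i hi v w
    obtain ⟨x, rfl⟩ := (bits_bijective n).2 v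
    obtain ⟨y, rfl⟩ := (bits_bijective n).2 w
    have := (mem_stabilizer_blocks (by omega)).1 (h (n - i) ⟨by omega, by omega⟩) x y
    rwa [Nat.sub_sub_self hi.le, ← hflag, ← hflag, ← symEquiv_apply_bits,
      ← symEquiv_apply_bits] at this
  · intro h m hm
    refine (mem_stabilizer_blocks hm.2).2 fun x y => ?_
    rw [← hflag, ← hflag, ← symEquiv_apply_bits, ← symEquiv_apply_bits]
    exact h _ (by omega) _ _

/-! ### The image of `U_n` in the permutations of 𝔽₂ⁿ -/

theorem mem_map_symEquiv {n : ℕ} {H : Subgroup (Sym n)} {f : Perm (Vec n)} :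
    f ∈ H.map (symEquiv n).toMonoidHom ↔ (symEquiv n).symm f ∈ H :=
  Subgroup.mem_map_equiv

theorem mem_map_AGL {n : ℕ} {f : Perm (Vec n)} :
    f ∈ (AGL n).map (symEquiv n).toMonoidHom ↔
      f ∈ Subgroup.normalizer (translations (flag n n) : Set (Perm (Vec n))) := by
  rw [← map_Tflag le_rfl, AGL, Subgroup.map_equiv_normalizer_eq]
  rfl

theorem mem_map_U {n : ℕ} {f : Perm (Vec n)} :
    f ∈ (U n).map (symEquiv n).toMonoidHom ↔
      f ∈ Subgroup.normalizer (translations (flag n n) : Set (Perm (Vec n))) ∧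
        ∀ i < n, ∀ v w : Vec n, v + w ∈ flag n i ↔ f v + f w ∈ flag n i := by
  rw [← mem_map_AGL, mem_map_symEquiv, mem_map_symEquiv, U, Subgroup.mem_inf, mem_SigmaGroup,
    MulEquiv.apply_symm_apply]

theorem addRight_mem_map_U {n : ℕ} (v : Vec n) :
    Equiv.addRight v ∈ (U n).map (symEquiv n).toMonoidHom := by
  refine mem_map_U.2 ⟨Subgroup.le_normalizer ⟨v, mem_flag_self v, rfl⟩, fun i _ x y => ?_⟩
  have : x + v + (y + v) = x + y + (v + v) := by abel
  rw [Equiv.coe_addRight, this, ZModModule.add_self, add_zero]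

theorem shear_mem_flag {n i : ℕ} {a b : Fin n} (h : a < b) {x : Vec n} (hx : x ∈ flag n i) :
    shear h x ∈ flag n i := by
  intro j hj
  rw [shear_apply, Pi.add_apply, hx j hj, zero_add, Pi.single_apply]
  split_ifs with hja
  · subst hja
    exact hx b (hj.trans (Fin.lt_def.1 h).le)
  · rfl

theorem shear_shear {n : ℕ} {a b : Fin n} (h : a < b) (x : Vec n) : shear h (shear h x) = x :=
  (shear h).left_inv x

theorem shear_mem_map_U {n : ℕ} {a b : Fin n} (h : a < b) :
    (shear h).toEquiv ∈ (U n).map (symEquiv n).toMonoidHom := by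
  refine mem_map_U.2 ⟨?_, fun i _ x y => ?_⟩
  · have key : ∀ f ∈ translations (flag n n),
        (shear h).toEquiv * f * (shear h).toEquiv⁻¹ ∈ translations (flag n n) := by
      rintro _ ⟨v, hv, rfl⟩
      exact ⟨shear h v, mem_flag_self _, conj_addRight fun x => by simp⟩
    have hinv : (shear h).toEquiv * (shear h).toEquiv = 1 := by
      ext1 x
      simp [shear_shear]
    have hinv' : (shear h).toEquiv⁻¹ = (shear h).toEquiv := inv_eq_of_mul_eq_one_left hinv
    refine Subgroup.mem_normalizer_iff.2 fun f => ⟨key f, fun hf => ?_⟩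
    have h1 := key _ hf
    rw [hinv'] at h1
    have h2 : (shear h).toEquiv * ((shear h).toEquiv * f * (shear h).toEquiv) * (shear h).toEquiv
        = ((shear h).toEquiv * (shear h).toEquiv) * f *
          ((shear h).toEquiv * (shear h).toEquiv) := by
      simp only [mul_assoc]
    rw [h2, hinv, one_mul, mul_one] at h1
    exact h1
  · have hadd : (shear h).toEquiv x + (shear h).toEquiv y = shear h (x + y) :=
      (map_add (shear h) x y).symm
    rw [hadd]
    refine ⟨shear_mem_flag h, fun h1 => ?_⟩
    rw [← shear_shear h (x + y)]
    exact shear_mem_flag h h1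

theorem affine_of_mem_map_U {n : ℕ} {u : Perm (Vec n)}
    (hu : u ∈ (U n).map (symEquiv n).toMonoidHom) (i : ℕ) {v : Vec n} (hv : v ∈ flag n i) :
    ∃ w ∈ flag n i, ∀ x, u (x + v) = u x + w := by
  obtain ⟨h1, h2⟩ := mem_map_U.1 hu
  obtain ⟨w, -, hw⟩ := (Subgroup.mem_normalizer_iff.1 h1 (Equiv.addRight v)).1
    ⟨v, mem_flag_self v, rfl⟩
  have key : ∀ x, u (x + v) = u x + w := fun x => by
    have := congrArg (fun f : Perm (Vec n) => f (u x)) hw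
    simpa using this
  refine ⟨w, ?_, key⟩
  by_cases hi : i < n
  · have h3 := (h2 i hi (0 + v) 0).1 (by simpa using hv)
    rw [key 0, add_right_comm, ZModModule.add_self, zero_add] at h3
    exact h3
  -- For `i ≥ n` the flag term is the whole space.
  · exact fun j hj => absurd j.2 (by omega)

end SylowChain

theorem mainTheorem6 (n i : ℕ) (hi : i + 2 ≤ n) :
    SylowChain.N n 1 ≤ Subgroup.normalizer (SylowChain.Tflag n i) := by
  intro g hg
  have hg' : SylowChain.symEquiv n g ∈
      (Subgroup.normalizer (SylowChain.U n : Set (SylowChain.Sym n))).map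
        (SylowChain.symEquiv n).toMonoidHom := ⟨g, hg, rfl⟩
  rw [Subgroup.map_equiv_normalizer_eq] at hg'
  have h := SylowChain.mem_normalizer_translations_flag SylowChain.addRight_mem_map_U
    (fun u hu i v hv => SylowChain.affine_of_mem_map_U hu i hv)
    (fun _ _ h => SylowChain.shear_mem_map_U h) hg' hi
  rw [← SylowChain.map_Tflag (by omega), ← Subgroup.map_equiv_normalizer_eq,
    SylowChain.mem_map_symEquiv, MulEquiv.symm_apply_apply] at h
  exact h
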